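/- Let $n\ge 2$. A copula is a function $C:[0,1]^n\to\mathbb R$ of the form $C(u)=m\big(\prod_{i=1}^n[0,u_i]\big)$, where $m$ is a probability measure on $[0,1]^n$ all of whose one-dimensional marginals are the Lebesgue measure on $[0,1]$; the measure $m$ is unique and is denoted $dC$. For a probability measure $\mu$ on $\mathbb R^n$ let $\mu_i$ be its $i$-th marginal and $F_{\mu_i}^{-1}(u)=\inf\{x\in\mathbb R:\mu_i((-\infty,x])\ge u\}$, $u\in(0,1)$. A copula $C$ is a copula of $\mu$ if $\mu\big(\prod_{i}(-\infty,x_i]\big)=C\big(\mu_1((-\infty,x_1]),\dots,\mu_n((-\infty,x_n])\big)$ for all $x\in\mathbb R^n$. If $C$ is a copula of both $\mu$ and $\rho$, let $\mu\diamond\rho$ be the image of $dC$ under $u\mapsto\big((F_{\mu_i}^{-1}(u_i))_{i},(F_{\rho_i}^{-1}(u_i))_{i}\big)\in\mathbb R^n\times\mathbb R^n$. For $p,q\in[1,\infty)$ let $\|x\|_q=\big(\sum_{i}|x_i|^q\big)^{1/q}$ and $$\mathcal W_{p,q}(\mu,\rho)=\inf_{\nu}\Big(\int_{\mathbb R^n\times\mathbb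 R^n}\|x-y\|_q^p\,\nu(dx,dy)\Big)^{1/p}\in[0,\infty],$$ the infimum being over all couplings $\nu$ of $\mu$ and $\rho$. Put $C_n^+(u)=\min_i u_i$ and $C_n^-(u)=(u_1+\dots+u_n-n+1)^+$. Let $C$ be a copula on $[0,1]^n$. (i) For all $p\in[1,\infty)$ and all probability measures $\mu,\rho$ on $\mathbb R^n$ that both have $C$ as a copula, $\mu\diamond\rho$ is a coupling of $\mu$ and $\rho$, it attains the infimum defining $\mathcal W_{p,p}(\mu,\rho)$, and, in $[0,\infty]$, $$\mathcal W_{p,p}^p(\mu,\rho)=\int_{[0,1]^n}\sum_{i=1}^n|F_{\mu_i}^{-1}(u_i)-F_{\rho_i}^{-1}(u_i)|^p\,dC(u)=\int_0^1\sum_{i=1}^n|F_{\mu_i}^{-1}(u)-F_{\rho_i}^{-1}(u)|^p\,du .$$ (ii) If $1\le p<q<\infty$ and $C\ne C_n^+$, there exist probability measures $\mu,\rho$ on $\mathbb R^n$, each having $C$ as its unique copula, such that $$\Big(\int_{\mathbb R^n\times\mathbb R^n}\|x-y\|_q^p\,(\mu\diamond\rho)(dx,dy)\Big)^{1/p}>\mathcal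 W_{p,q}(\mu,\rho).$$ (iii) If $1\le q<p<\infty$, and either $n\ge3$, or $n=2$ and $C\ne C_2^-$, there exist probability measures $\mu,\rho$ on $\mathbb R^n$ with the same properties as in (ii). -/

import Mathlib

open MeasureTheory
open scoped ENNReal

noncomputable section

/-- `m` is the probability measure `dC` on `[0,1]^n` of the function `C`: all its one-dimensional
marginals are the Lebesgue measure on `[0,1]`, and `C u = m (∏ i, [0, u i])`. -/
def IsCopulaLaw {n : ℕ} (C : (Fin n → unitInterval) → ℝ)
    (m : Measure (Fin n → unitInterval)) : Prop :=
  IsProbabilityMeasure m ∧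
    (∀ i, m.map (fun u => u i) = (volume : Measure unitInterval)) ∧
    ∀ u, C u = m.real (Set.univ.pi fun i => Set.Icc 0 (u i))

/-- `C : [0,1]^n → ℝ` is a copula function. -/
def IsCopula {n : ℕ} (C : (Fin n → unitInterval) → ℝ) : Prop :=
  ∃ m : Measure (Fin n → unitInterval), IsCopulaLaw C m

open Classical in
/-- The probability measure `dC` of a copula `C` (and `0` if `C` is not a copula). -/
def copulaMeasure {n : ℕ} (C : (Fin n → unitInterval) → ℝ) : Measure (Fin n → unitInterval) :=
  if h : IsCopula C then h.choose else 0

theorem IsCopula.isCopulaLaw_copulaMeasure {n : ℕ} {C : (Fin n → unitInterval) → ℝ}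
    (h : IsCopula C) : IsCopulaLaw C (copulaMeasure C) := by
  rw [copulaMeasure, dif_pos h]
  exact h.choose_spec

/-- The measure `dC` is determined by the copula `C`. -/
theorem IsCopulaLaw.eq_copulaMeasure {n : ℕ} {C : (Fin n → unitInterval) → ℝ}
    {m : Measure (Fin n → unitInterval)} (hm : IsCopulaLaw C m) : m = copulaMeasure C := by
  have hm' : IsCopulaLaw C (copulaMeasure C) := IsCopula.isCopulaLaw_copulaMeasure ⟨m, hm⟩
  obtain ⟨hp, -, h⟩ := hm
  obtain ⟨hp', -, h'⟩ := hm'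
  let E : Fin n → Set (Set unitInterval) := fun _ => Set.range Set.Iic
  have hgen : MeasurableSpace.pi = MeasurableSpace.generateFrom (Set.univ.pi '' Set.univ.pi E) := by
    refine (generateFrom_eq_pi (C := E) (fun i => ?_) (fun i => ?_)).symm
    · exact (borel_eq_generateFrom_Iic unitInterval).symm.trans
        (BorelSpace.measurable_eq (α := unitInterval)).symm
    · exact ⟨fun _ => Set.Iic 1, fun _ => ⟨1, rfl⟩,
        Set.eq_univ_of_forall fun x => Set.mem_iUnion.2 ⟨0, unitInterval.le_one x⟩⟩
  refine ext_of_generate_finite _ hgen (IsPiSystem.pi fun i => ?_) ?_ (by simp)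
  · exact isPiSystem_image_Iic Set.univ |> fun h => by simpa [E, Set.image_univ] using h
  · rintro _ ⟨s, hs, rfl⟩
    choose u hu using fun i => hs i (Set.mem_univ i)
    have hs' : Set.univ.pi s = Set.univ.pi fun i => Set.Icc 0 (u i) := by
      congr 1
      funext i
      rw [← hu i]
      ext x
      simp
    have hreal := (h u).symm.trans (h' u)
    rw [hs']
    exact (measureReal_eq_measureReal_iff).1 hreal

/-- The upper Fréchet-Hoeffding bound `C_n^+ (u) = min (u_1, ..., u_n)`. -/
def frechetUpper (n : ℕ) (u : Fin n → unitInterval) : ℝ := ⨅ i, (u i : ℝ)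

/-- The lower Fréchet-Hoeffding bound `C_n^- (u) = (u_1 + ... + u_n - n + 1)^+`. -/
def frechetLower (n : ℕ) (u : Fin n → unitInterval) : ℝ := max ((∑ i, (u i : ℝ)) - n + 1) 0

/-- The `i`-th marginal of a measure on `ℝ^n`. -/
def marginal {n : ℕ} (μ : Measure (Fin n → ℝ)) (i : Fin n) : Measure ℝ :=
  μ.map fun x => x i

instance {n : ℕ} (μ : Measure (Fin n → ℝ)) [IsProbabilityMeasure μ] (i : Fin n) :
    IsProbabilityMeasure (marginal μ i) :=
  Measure.isProbabilityMeasure_map (measurable_pi_apply i).aemeasurable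

/-- The cumulative distribution function of a probability measure on `ℝ`, with values in `[0,1]`. -/
def unitCdf (ν : Measure ℝ) [IsProbabilityMeasure ν] (x : ℝ) : unitInterval :=
  ⟨ν.real (Set.Iic x), measureReal_nonneg, measureReal_le_one⟩

/-- The pseudo-inverse of the cumulative distribution function of `ν`; only its values at
`u ∈ (0,1)` are meaningful. -/
def quantile (ν : Measure ℝ) (u : ℝ) : ℝ := sInf {x : ℝ | u ≤ ν.real (Set.Iic x)}

/-- `C` is a copula of the probability measure `μ` on `ℝ^n`. -/
def HasCopula {n : ℕ} (μ : Measure (Fin n → ℝ)) [IsProbabilityMeasure μ]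
    (C : (Fin n → unitInterval) → ℝ) : Prop :=
  IsCopula C ∧ ∀ x : Fin n → ℝ,
    μ.real (Set.univ.pi fun i => Set.Iic (x i)) = C fun i => unitCdf (marginal μ i) (x i)

/-- `C` is the one and only copula of the probability measure `μ` on `ℝ^n`. -/
def HasUniqueCopula {n : ℕ} (μ : Measure (Fin n → ℝ)) [IsProbabilityMeasure μ]
    (C : (Fin n → unitInterval) → ℝ) : Prop :=
  HasCopula μ C ∧ ∀ C' : (Fin n → unitInterval) → ℝ, HasCopula μ C' → C' = C

/-- `ν` is a coupling of `μ` and `ρ`. -/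
def IsCoupling {n : ℕ} (ν : Measure ((Fin n → ℝ) × (Fin n → ℝ))) (μ ρ : Measure (Fin n → ℝ)) :
    Prop :=
  ν.map Prod.fst = μ ∧ ν.map Prod.snd = ρ

/-- The norm `‖x‖_q` on `ℝ^n`. -/
def lqNorm {n : ℕ} (q : ℝ) (x : Fin n → ℝ) : ℝ := (∑ i, |x i| ^ q) ^ (1 / q)

/-- `∫ ‖x - y‖_q ^ p ν(dx, dy)`, with values in `[0, ∞]`. -/
def transportCost {n : ℕ} (p q : ℝ) (ν : Measure ((Fin n → ℝ) × (Fin n → ℝ))) : ℝ≥0∞ :=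
  ∫⁻ z, ENNReal.ofReal (lqNorm q (z.1 - z.2) ^ p) ∂ν

/-- The Wasserstein distance `W_{p,q}(μ, ρ)`, with values in `[0, ∞]`. -/
def wasserstein {n : ℕ} (p q : ℝ) (μ ρ : Measure (Fin n → ℝ)) : ℝ≥0∞ :=
  ⨅ (ν : Measure ((Fin n → ℝ) × (Fin n → ℝ))) (_ : IsCoupling ν μ ρ),
    transportCost p q ν ^ (1 / p)

/-- The law `μ ⋄ ρ` with respect to the copula `C`: the image of `dC` under
`u ↦ ((F_{μ_i}^{-1}(u_i))_i, (F_{ρ_i}^{-1}(u_i))_i)`. -/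
def diamond {n : ℕ} (C : (Fin n → unitInterval) → ℝ) (μ ρ : Measure (Fin n → ℝ)) :
    Measure ((Fin n → ℝ) × (Fin n → ℝ)) :=
  (copulaMeasure C).map fun u =>
    (fun i => quantile (marginal μ i) (u i), fun i => quantile (marginal ρ i) (u i))

end

/-! When both exponents equal `p`, the cost is a sum over coordinates, so any coupling costs at
least the sum of the one-dimensional optima. On the line the quantile coupling is optimal for `|x -
y| ^ p`. Under `dC` each coordinate is uniform, so `diamond` restricts to the quantile coupling in
every coordinate and attains all these bounds at once, whatever the dependence encoded by `C`.
One-dimensional optimality (`lintegral_ofReal_quantile_sub_rpow_le`) comes from writing `(y - x)₊ ^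
p` as a mixture of indicators of `x ≤ s, t < y`. A coupling of `α` and `β` gives such an event mass
at least `(F_α(s) - F_β(t))₊`, and the quantile coupling gives exactly that.

When `p ≠ q` the cost couples the coordinates, and a swap beats the diagonal coupling of `dC`
(`exists_coupling_lintegral_lt`). Take `x = f(u)`, `y = g(v)`, where `f` lowers coordinate `j` by
`1` when `u_j ≤ b` and `g` lowers coordinate `i` by `1` when `v_i ≤ a`. The cost is then `0`, `1` or
`2 ^ (p / q)` according to how many of the two events occur. If `p < q`, then `2 ^ (p / q) < 2` and
it pays to bring the two defects together; if `q < p`, it pays to separate them. A small tilt `ε t`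
makes the maps strictly increasing, which forces uniqueness of the copula, and the strict gap
survives by continuity.

It remains to find `i, j, a, b` for which `dC` charges the two regions to be swapped. This fails for
`p < q` only if `C` is the upper Fréchet bound (`IsCopulaLaw.eq_frechetUpper`), and for `q < p` only
if `n = 2` and `C` is the lower one (`IsCopulaLaw.exists_inter_ne_zero`). -/

/-! ### Optimality of the quantile coupling on the line -/

/-- Taylor's formula with integral remainder: `l` is the second derivative of the convex function
`D₊ ^ p`, which is a Dirac mass at `0` for `p = 1` and has density `p (p - 1) r ^ (p - 2)` on `r >
0` otherwise. -/
theorem exists_measure_lintegral_ofReal_sub {p : ℝ} (hp : 1 ≤ p) :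
    ∃ l : Measure ℝ, SFinite l ∧
      ∀ D : ℝ, ∫⁻ r, ENNReal.ofReal (D - r) ∂l = ENNReal.ofReal D ^ p := by
  rcases hp.eq_or_lt with rfl | hp
  · exact ⟨Measure.dirac 0, inferInstance, fun D => by simp⟩
  have hm : Measurable fun r : ℝ => ENNReal.ofReal (p * (p - 1) * r ^ (p - 2)) := by fun_prop
  refine ⟨(volume.restrict (Set.Ioi 0)).withDensity
    fun r => ENNReal.ofReal (p * (p - 1) * r ^ (p - 2)), inferInstance, fun D => ?_⟩
  rw [lintegral_withDensity_eq_lintegral_mul _ hm (by fun_prop)]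
  rcases le_or_gt D 0 with hD | hD
  · rw [ENNReal.ofReal_of_nonpos hD, ENNReal.zero_rpow_of_pos (by linarith),
      setLIntegral_congr_fun (g := fun _ => 0) measurableSet_Ioi, lintegral_zero]
    intro r hr
    have : ENNReal.ofReal (D - r) = 0 :=
      ENNReal.ofReal_of_nonpos (by linarith [Set.mem_Ioi.1 hr])
    simp [this]
  -- The singularity at `0` is integrable because `p > 1` gives `p - 2 > -1`.
  have h1 : IntervalIntegrable (fun r : ℝ => r ^ (p - 2)) volume 0 D :=
    intervalIntegral.intervalIntegrable_rpow' (by linarith)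
  have h2 : IntervalIntegrable (fun r : ℝ => r ^ (p - 1)) volume 0 D :=
    intervalIntegral.intervalIntegrable_rpow' (by linarith)
  have h3 : IntervalIntegrable
      (fun r : ℝ => p * (p - 1) * D * r ^ (p - 2) - p * (p - 1) * r ^ (p - 1)) volume 0 D :=
    (h1.const_mul _).sub (h2.const_mul _)
  have heq : ∀ r ∈ Set.Ioc 0 D, p * (p - 1) * r ^ (p - 2) * (D - r) =
      p * (p - 1) * D * r ^ (p - 2) - p * (p - 1) * r ^ (p - 1) := by
    intro r hr
    have : r ^ (p - 1) = r ^ (p - 2) * r := by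
      rw [← Real.rpow_add_one hr.1.ne']
      ring_nf
    rw [this]
    ring
  have hval : ∫ r in (0 : ℝ)..D,
      (p * (p - 1) * D * r ^ (p - 2) - p * (p - 1) * r ^ (p - 1)) = D ^ p := by
    rw [intervalIntegral.integral_sub (h1.const_mul _) (h2.const_mul _),
      intervalIntegral.integral_const_mul, intervalIntegral.integral_const_mul,
      integral_rpow (Or.inl (by linarith)), integral_rpow (Or.inl (by linarith)),
      Real.zero_rpow (by linarith), Real.zero_rpow (by linarith)]
    have e1 : p - 2 + 1 = p - 1 := by ring
    have e2 : D ^ p = D ^ (p - 1) * D := by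
      rw [← Real.rpow_add_one hD.ne']
      ring_nf
    rw [e1, show p - 1 + 1 = p by ring, e2]
    have : p - 1 ≠ 0 := by linarith
    have : p ≠ 0 := by linarith
    field_simp
    ring
  have hsplit : ∫⁻ r in Set.Ioi (0 : ℝ),
      ((fun r => ENNReal.ofReal (p * (p - 1) * r ^ (p - 2))) *
        fun r => ENNReal.ofReal (D - r)) r =
      ∫⁻ r in Set.Ioc (0 : ℝ) D, ENNReal.ofReal
        (p * (p - 1) * D * r ^ (p - 2) - p * (p - 1) * r ^ (p - 1)) := by
    rw [← Set.Ioc_union_Ioi_eq_Ioi hD.le,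
      lintegral_union measurableSet_Ioi (Set.Ioc_disjoint_Ioi le_rfl),
      setLIntegral_congr_fun (g := fun _ => 0) measurableSet_Ioi, lintegral_zero, add_zero]
    · refine setLIntegral_congr_fun measurableSet_Ioc fun r hr => ?_
      have hnn : 0 ≤ p * (p - 1) * r ^ (p - 2) :=
        mul_nonneg (mul_nonneg (by linarith) (by linarith)) (Real.rpow_nonneg hr.1.le _)
      simp only [Pi.mul_apply]
      rw [← ENNReal.ofReal_mul hnn, heq r hr]
    · intro r hr
      have : ENNReal.ofReal (D - r) = 0 :=
        ENNReal.ofReal_of_nonpos (by linarith [Set.mem_Ioi.1 hr])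
      simp [this]
  rw [hsplit, ← ofReal_integral_eq_lintegral_ofReal
    ((intervalIntegrable_iff_integrableOn_Ioc_of_le hD.le).1 h3),
    ← intervalIntegral.integral_of_le hD.le, hval, ENNReal.ofReal_rpow_of_pos hD]
  filter_upwards [ae_restrict_mem measurableSet_Ioc] with r hr
  rw [← heq r hr]
  exact mul_nonneg (mul_nonneg (mul_nonneg (by linarith) (by linarith))
    (Real.rpow_nonneg hr.1.le _)) (by linarith [hr.2])

theorem measurableSet_setOf_le_and_lt {Ω : Type*} [MeasurableSpace Ω] {f g h k : Ω → ℝ}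
    (hf : Measurable f) (hg : Measurable g) (hh : Measurable h) (hk : Measurable k) :
    MeasurableSet {a | f a ≤ g a ∧ h a < k a} := by
  rw [Set.ofPred_and]
  exact (measurableSet_le hf hg).inter (measurableSet_lt hh hk)

theorem measurableSet_straddle :
    MeasurableSet {z : (ℝ × ℝ) × (ℝ × ℝ) | z.1.1 ≤ z.2.1 ∧ z.2.2 < z.1.2} :=
  measurableSet_setOf_le_and_lt (by fun_prop) (by fun_prop) (by fun_prop) (by fun_prop)

/-- Take `w = (s, s + r)` with `s` Lebesgue and `r` distributed by `l`: for fixed `r` the admissible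
`s` fill `[x, y - r)`, of length `(y - x - r)₊`. -/
theorem exists_measure_straddle {p : ℝ} (hp : 1 ≤ p) :
    ∃ κ : Measure (ℝ × ℝ), SFinite κ ∧
      ∀ x y : ℝ, κ {w | x ≤ w.1 ∧ w.2 < y} = ENNReal.ofReal (y - x) ^ p := by
  obtain ⟨l, hl, h⟩ := exists_measure_lintegral_ofReal_sub hp
  have hm : Measurable fun w : ℝ × ℝ => (w.1, w.1 + w.2) := by fun_prop
  refine ⟨((volume : Measure ℝ).prod l).map fun w => (w.1, w.1 + w.2), inferInstance,
    fun x y => ?_⟩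
  have hs : MeasurableSet {w : ℝ × ℝ | x ≤ w.1 ∧ w.2 < y} :=
    measurableSet_setOf_le_and_lt (by fun_prop) (by fun_prop) (by fun_prop) (by fun_prop)
  rw [Measure.map_apply hm hs, Measure.prod_apply_symm (hm hs), ← h]
  refine lintegral_congr fun r => ?_
  have : (fun s : ℝ => (s, r)) ⁻¹' ((fun w : ℝ × ℝ => (w.1, w.1 + w.2)) ⁻¹'
      {w : ℝ × ℝ | x ≤ w.1 ∧ w.2 < y}) = Set.Ico x (y - r) := by
    ext s
    simp [lt_sub_iff_add_lt]
  rw [this, Real.volume_Ico]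
  congr 1
  ring

theorem lintegral_straddle (γ κ : Measure (ℝ × ℝ)) [SFinite γ] [SFinite κ] :
    ∫⁻ z, κ {w | z.1 ≤ w.1 ∧ w.2 < z.2} ∂γ = ∫⁻ w, γ {z | z.1 ≤ w.1 ∧ w.2 < z.2} ∂κ := by
  have h1 := Measure.prod_apply (μ := γ) (ν := κ) measurableSet_straddle
  have h2 := Measure.prod_apply_symm (μ := γ) (ν := κ) measurableSet_straddle
  exact h1.symm.trans h2

/-- Right continuity of the distribution function makes the infimum attained; `0 < u < 1` makes the
set bounded below and nonempty. -/
theorem quantile_le_iff (ν : Measure ℝ) [IsProbabilityMeasure ν] {u : ℝ}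
    (h0 : 0 < u) (h1 : u < 1) (x : ℝ) :
    quantile ν u ≤ x ↔ u ≤ ν.real (Set.Iic x) := by
  have hF : ∀ x, ν.real (Set.Iic x) = ProbabilityTheory.cdf ν x := fun x =>
    (ProbabilityTheory.cdf_eq_real ν x).symm
  have hmono : Monotone (ProbabilityTheory.cdf ν) := ProbabilityTheory.monotone_cdf ν
  simp only [quantile, hF]
  have hne : {x : ℝ | u ≤ ProbabilityTheory.cdf ν x}.Nonempty :=
    ((ProbabilityTheory.tendsto_cdf_atTop ν).eventually (lt_mem_nhds h1)).exists.imp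
      fun _ h => h.le
  have hbdd : BddBelow {x : ℝ | u ≤ ProbabilityTheory.cdf ν x} := by
    obtain ⟨y, hy⟩ :=
      ((ProbabilityTheory.tendsto_cdf_atBot ν).eventually (gt_mem_nhds h0)).exists
    exact ⟨y, fun x hx => le_of_not_gt fun hxy => absurd (hmono hxy.le) (by
      simp only [Set.mem_ofPred_eq] at hx
      linarith)⟩
  constructor
  · intro hx
    refine le_trans ?_ (hmono hx)
    set a := sInf {x : ℝ | u ≤ ProbabilityTheory.cdf ν x}
    have ht : Filter.Tendsto (ProbabilityTheory.cdf ν) (nhdsWithin a (Set.Ioi a))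
        (nhds (ProbabilityTheory.cdf ν a)) :=
      ((ProbabilityTheory.cdf ν).right_continuous a).tendsto.mono_left
        (nhdsWithin_mono _ Set.Ioi_subset_Ici_self)
    refine ge_of_tendsto ht ?_
    filter_upwards [self_mem_nhdsWithin] with y hy
    obtain ⟨s, hs, hsy⟩ := exists_lt_of_csInf_lt hne hy
    exact le_trans hs (hmono hsy.le)
  · exact fun h => csInf_le hbdd h

theorem unitInterval.ae_pos_lt_one :
    ∀ᵐ u : unitInterval, (0 : ℝ) < u ∧ (u : ℝ) < 1 := by
  filter_upwards [compl_mem_ae_iff.2 (measure_singleton (0 : unitInterval)),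
    compl_mem_ae_iff.2 (measure_singleton (1 : unitInterval))] with u h0 h1
  exact ⟨unitInterval.pos_iff_ne_zero.2 h0, unitInterval.lt_one_iff_ne_one.2 h1⟩

theorem measurable_quantile (ν : Measure ℝ) [IsProbabilityMeasure ν] :
    Measurable fun u : unitInterval => quantile ν u := by
  refine measurable_of_measurable_on_compl_finite {0, 1} (Set.toFinite _) ?_
  refine measurable_of_Iic fun x => ?_
  have : ({0, 1}ᶜ : Set unitInterval).domRestrict (fun u : unitInterval => quantile ν u) ⁻¹'
      Set.Iic x = Subtype.val ⁻¹' {u : unitInterval | (u : ℝ) ≤ ν.real (Set.Iic x)} := by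
    ext ⟨u, hu⟩
    simp only [Set.mem_compl_iff, Set.mem_insert_iff, Set.mem_singleton_iff, not_or] at hu
    simpa using quantile_le_iff ν (unitInterval.pos_iff_ne_zero.2 hu.1)
      (unitInterval.lt_one_iff_ne_one.2 hu.2) x
  rw [this]
  exact measurable_subtype_coe (measurableSet_le (by fun_prop) (by fun_prop))

/-- By Tonelli both sides are integrals over `κ` of the masses of the events `z.1 ≤ w.1 ∧ w.2 <
z.2`, so it suffices to compare these masses for each `w`. -/
theorem lintegral_ofReal_quantile_sub_rpow_le {α β : Measure ℝ} [IsProbabilityMeasure α]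
    [IsProbabilityMeasure β] {γ : Measure (ℝ × ℝ)} (hα : γ.map Prod.fst = α)
    (hβ : γ.map Prod.snd = β) {p : ℝ} (hp : 1 ≤ p) :
    ∫⁻ u : unitInterval, ENNReal.ofReal (quantile β u - quantile α u) ^ p ≤
      ∫⁻ z, ENNReal.ofReal (z.2 - z.1) ^ p ∂γ := by
  have : IsProbabilityMeasure γ :=
    ⟨by rw [← Set.preimage_univ (f := Prod.fst), ← Measure.map_apply measurable_fst .univ, hα,
      measure_univ]⟩
  obtain ⟨κ, hκ, h⟩ := exists_measure_straddle hp
  have hq : Measurable fun u : unitInterval => (quantile α u, quantile β u) :=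
    (measurable_quantile α).prodMk (measurable_quantile β)
  have hcost : Measurable fun z : ℝ × ℝ => ENNReal.ofReal (z.2 - z.1) ^ p := by fun_prop
  rw [← lintegral_map (μ := volume) (f := fun z : ℝ × ℝ => ENNReal.ofReal (z.2 - z.1) ^ p)
    hcost hq]
  simp_rw [← h]
  rw [lintegral_straddle, lintegral_straddle]
  refine lintegral_mono fun w => ?_
  have hs : MeasurableSet {z : ℝ × ℝ | z.1 ≤ w.1 ∧ w.2 < z.2} :=
    measurableSet_setOf_le_and_lt (by fun_prop) (by fun_prop) (by fun_prop) (by fun_prop)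
  have hlow : α (Set.Iic w.1) - β (Set.Iic w.2) ≤ γ {z : ℝ × ℝ | z.1 ≤ w.1 ∧ w.2 < z.2} := by
    rw [← hα, ← hβ, Measure.map_apply measurable_fst measurableSet_Iic,
      Measure.map_apply measurable_snd measurableSet_Iic]
    refine le_measure_sdiff.trans (measure_mono ?_)
    rintro z ⟨hz1, hz2⟩
    exact ⟨hz1, not_le.1 hz2⟩
  refine le_trans ?_ hlow
  rw [Measure.map_apply hq hs]
  set a : unitInterval := unitCdf α w.1
  set b : unitInterval := unitCdf β w.2
  -- Truncated subtraction matches the interval being empty when `a ≤ b`. Almost every `u` in the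
  -- event for the quantile coupling lies in `(b, a]`.
  have hab : volume (Set.Ioc b a) = α (Set.Iic w.1) - β (Set.Iic w.2) := by
    rw [unitInterval.volume_Ioc, ENNReal.ofReal_sub _ b.2.1]
    simp [a, b, unitCdf]
  rw [← hab]
  refine measure_mono_ae ?_
  filter_upwards [unitInterval.ae_pos_lt_one] with u hu hz
  have hz' : quantile α u ≤ w.1 ∧ w.2 < quantile β u := hz
  rw [← not_le, quantile_le_iff α hu.1 hu.2,
    quantile_le_iff β hu.1 hu.2, not_le] at hz'
  exact ⟨hz'.2, hz'.1⟩

theorem ofReal_abs_sub_rpow {p : ℝ} (hp : 1 ≤ p) (x y : ℝ) :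
    ENNReal.ofReal (|x - y| ^ p) =
      ENNReal.ofReal (y - x) ^ p + ENNReal.ofReal (x - y) ^ p := by
  rw [← ENNReal.ofReal_rpow_of_nonneg (abs_nonneg _) (by linarith)]
  rcases le_total x y with h | h
  · rw [abs_sub_comm, abs_of_nonneg (by linarith), ENNReal.ofReal_of_nonpos (p := x - y)
      (by linarith), ENNReal.zero_rpow_of_pos (by linarith), add_zero]
  · rw [abs_of_nonneg (by linarith), ENNReal.ofReal_of_nonpos (p := y - x)
      (by linarith), ENNReal.zero_rpow_of_pos (by linarith), zero_add]

theorem lintegral_abs_quantile_sub_rpow_le {α β : Measure ℝ} [IsProbabilityMeasure α]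
    [IsProbabilityMeasure β] {γ : Measure (ℝ × ℝ)} (hα : γ.map Prod.fst = α)
    (hβ : γ.map Prod.snd = β) {p : ℝ} (hp : 1 ≤ p) :
    ∫⁻ u : unitInterval, ENNReal.ofReal (|quantile α u - quantile β u| ^ p) ≤
      ∫⁻ z, ENNReal.ofReal (|z.1 - z.2| ^ p) ∂γ := by
  simp_rw [ofReal_abs_sub_rpow hp]
  have ha := measurable_quantile α
  have hb := measurable_quantile β
  rw [lintegral_add_left (by fun_prop), lintegral_add_left (by fun_prop)]
  refine add_le_add (lintegral_ofReal_quantile_sub_rpow_le hα hβ hp) ?_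
  have h1 : (γ.map Prod.swap).map Prod.fst = β := by
    rw [Measure.map_map measurable_fst measurable_swap]
    exact hβ
  have h2 : (γ.map Prod.swap).map Prod.snd = α := by
    rw [Measure.map_map measurable_snd measurable_swap]
    exact hα
  refine (lintegral_ofReal_quantile_sub_rpow_le h1 h2 hp).trans_eq ?_
  rw [lintegral_map (by fun_prop) measurable_swap]
  rfl

/-! ### Equal exponents: reduction to the coordinates -/

theorem IsCopulaLaw.ae_eval {n : ℕ} {C : (Fin n → unitInterval) → ℝ}
    {m : Measure (Fin n → unitInterval)} (h : IsCopulaLaw C m) {P : unitInterval → Prop} (i : Fin n)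
    (hP : ∀ᵐ t, P t) : ∀ᵐ u ∂m, P (u i) := by
  rw [← h.2.1 i] at hP
  exact ae_of_ae_map (measurable_pi_apply i).aemeasurable hP

theorem IsCopulaLaw.lintegral_eval {n : ℕ} {C : (Fin n → unitInterval) → ℝ}
    {m : Measure (Fin n → unitInterval)} (h : IsCopulaLaw C m) {f : unitInterval → ℝ≥0∞}
    (hf : Measurable f) (i : Fin n) : ∫⁻ u, f (u i) ∂m = ∫⁻ t, f t := by
  rw [← h.2.1 i, lintegral_map hf (measurable_pi_apply i)]

theorem measure_ext_of_pi_Iic {n : ℕ} {μ ρ : Measure (Fin n → ℝ)} [IsProbabilityMeasure μ]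
    [IsProbabilityMeasure ρ]
    (h : ∀ x : Fin n → ℝ, μ (Set.univ.pi fun i => Set.Iic (x i)) =
      ρ (Set.univ.pi fun i => Set.Iic (x i))) : μ = ρ := by
  let E : Fin n → Set (Set ℝ) := fun _ => Set.range Set.Iic
  have hgen : MeasurableSpace.pi = MeasurableSpace.generateFrom (Set.univ.pi '' Set.univ.pi E) := by
    refine (generateFrom_eq_pi (C := E) (fun i => ?_) (fun i => ?_)).symm
    · exact (borel_eq_generateFrom_Iic ℝ).symm.trans
        (BorelSpace.measurable_eq (α := ℝ)).symm
    · exact ⟨fun k : ℕ => Set.Iic (k : ℝ), fun k => ⟨k, rfl⟩,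
        Set.eq_univ_of_forall fun x => Set.mem_iUnion.2 (exists_nat_ge x)⟩
  refine ext_of_generate_finite _ hgen (IsPiSystem.pi fun i => ?_) ?_ (by simp)
  · exact isPiSystem_image_Iic Set.univ |> fun h => by simpa [E, Set.image_univ] using h
  · rintro _ ⟨s, hs, rfl⟩
    choose x hx using fun i => hs i (Set.mem_univ i)
    obtain rfl : s = fun i => Set.Iic (x i) := funext fun i => (hx i).symm
    exact h x

theorem measurable_quantile_pi {n : ℕ} (μ : Measure (Fin n → ℝ)) [IsProbabilityMeasure μ] :
    Measurable fun (u : Fin n → unitInterval) i => quantile (marginal μ i) (u i) :=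
  measurable_pi_lambda _ fun i => (measurable_quantile (marginal μ i)).comp (measurable_pi_apply i)

theorem HasCopula.map_quantile {n : ℕ} {C : (Fin n → unitInterval) → ℝ} {μ : Measure (Fin n → ℝ)}
    [IsProbabilityMeasure μ] (h : HasCopula μ C) :
    ((copulaMeasure C).map fun u i => quantile (marginal μ i) (u i)) = μ := by
  have hm := h.1.isCopulaLaw_copulaMeasure
  have := hm.1
  have hq := measurable_quantile_pi μ
  have : IsProbabilityMeasure
      ((copulaMeasure C).map fun u i => quantile (marginal μ i) (u i)) :=
    Measure.isProbabilityMeasure_map hq.aemeasurable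
  refine measure_ext_of_pi_Iic fun x => ?_
  rw [Measure.map_apply hq (MeasurableSet.univ_pi fun i => measurableSet_Iic)]
  have hx := (h.2 x).trans (hm.2.2 _)
  rw [measureReal_eq_measureReal_iff] at hx
  rw [hx]
  refine measure_congr (Filter.eventuallyEq_set.2 ?_)
  filter_upwards [ae_all_iff.2 fun i => hm.ae_eval i unitInterval.ae_pos_lt_one] with u hu
  simp only [Set.mem_preimage, Set.mem_univ_pi, Set.mem_Iic, Set.mem_Icc]
  refine forall_congr' fun i => ?_
  rw [quantile_le_iff _ (hu i).1 (hu i).2]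
  exact ⟨fun h => ⟨unitInterval.nonneg', h⟩, fun h => h.2⟩

theorem isCoupling_diamond {n : ℕ} {C : (Fin n → unitInterval) → ℝ} {μ ρ : Measure (Fin n → ℝ)}
    [IsProbabilityMeasure μ] [IsProbabilityMeasure ρ] (hμ : HasCopula μ C) (hρ : HasCopula ρ C) :
    IsCoupling (diamond C μ ρ) μ ρ := by
  have hq := (measurable_quantile_pi μ).prodMk (measurable_quantile_pi ρ)
  constructor
  · rw [diamond, Measure.map_map measurable_fst hq]
    exact hμ.map_quantile
  · rw [diamond, Measure.map_map measurable_snd hq]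
    exact hρ.map_quantile

theorem lqNorm_nonneg {n : ℕ} (q : ℝ) (x : Fin n → ℝ) : 0 ≤ lqNorm q x :=
  Real.rpow_nonneg (Finset.sum_nonneg fun _ _ => Real.rpow_nonneg (abs_nonneg _) _) _

theorem lqNorm_rpow_self {n : ℕ} {p : ℝ} (hp : p ≠ 0) (x : Fin n → ℝ) :
    lqNorm p x ^ p = ∑ i, |x i| ^ p := by
  rw [lqNorm, ← Real.rpow_mul (Finset.sum_nonneg fun _ _ => Real.rpow_nonneg (abs_nonneg _) _),
    one_div, inv_mul_cancel₀ hp, Real.rpow_one]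

theorem transportCost_self_eq_sum {n : ℕ} {p : ℝ} (hp : p ≠ 0)
    (ν : Measure ((Fin n → ℝ) × (Fin n → ℝ))) :
    transportCost p p ν = ∑ i, ∫⁻ z, ENNReal.ofReal (|z.1 i - z.2 i| ^ p) ∂ν := by
  rw [transportCost, ← lintegral_finsetSum _ fun i _ => by fun_prop]
  refine lintegral_congr fun z => ?_
  rw [lqNorm_rpow_self hp,
    ENNReal.ofReal_sum_of_nonneg fun i _ => Real.rpow_nonneg (abs_nonneg _) _]
  rfl

theorem transportCost_diamond_self {n : ℕ} {C : (Fin n → unitInterval) → ℝ} (hC : IsCopula C)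
    {p : ℝ} (hp : p ≠ 0) (μ ρ : Measure (Fin n → ℝ)) [IsProbabilityMeasure μ]
    [IsProbabilityMeasure ρ] :
    transportCost p p (diamond C μ ρ) = ∑ i, ∫⁻ t : unitInterval,
      ENNReal.ofReal (|quantile (marginal μ i) t - quantile (marginal ρ i) t| ^ p) := by
  have hm := hC.isCopulaLaw_copulaMeasure
  rw [transportCost_self_eq_sum hp]
  refine Finset.sum_congr rfl fun i _ => ?_
  have hq := (measurable_quantile_pi μ).prodMk (measurable_quantile_pi ρ)
  have h1 := measurable_quantile (marginal μ i)
  have h2 := measurable_quantile (marginal ρ i)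
  rw [diamond, lintegral_map (by fun_prop) hq]
  exact hm.lintegral_eval (f := fun t =>
    ENNReal.ofReal (|quantile (marginal μ i) t - quantile (marginal ρ i) t| ^ p))
    (by fun_prop) i

theorem transportCost_diamond_self_le {n : ℕ} {C : (Fin n → unitInterval) → ℝ} (hC : IsCopula C)
    {p : ℝ} (hp : 1 ≤ p) {μ ρ : Measure (Fin n → ℝ)} [IsProbabilityMeasure μ]
    [IsProbabilityMeasure ρ] {ν : Measure ((Fin n → ℝ) × (Fin n → ℝ))} (hν : IsCoupling ν μ ρ) :
    transportCost p p (diamond C μ ρ) ≤ transportCost p p ν := by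
  have hp0 : p ≠ 0 := by linarith
  rw [transportCost_diamond_self hC hp0, transportCost_self_eq_sum hp0]
  refine Finset.sum_le_sum fun i _ => ?_
  have hm : Measurable fun z : (Fin n → ℝ) × (Fin n → ℝ) => (z.1 i, z.2 i) := by fun_prop
  -- The `i`-th coordinates of `ν` couple the `i`-th marginals.
  refine (lintegral_abs_quantile_sub_rpow_le (γ := ν.map fun z => (z.1 i, z.2 i)) ?_ ?_ hp).trans_eq
    (lintegral_map (by fun_prop) hm)
  · rw [Measure.map_map measurable_fst hm, marginal, ← hν.1,
      Measure.map_map (measurable_pi_apply i) measurable_fst]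
    rfl
  · rw [Measure.map_map measurable_snd hm, marginal, ← hν.2,
      Measure.map_map (measurable_pi_apply i) measurable_snd]
    rfl

theorem transportCost_diamond_self_eq_wasserstein {n : ℕ} {C : (Fin n → unitInterval) → ℝ} {p : ℝ}
    (hp : 1 ≤ p) {μ ρ : Measure (Fin n → ℝ)} [IsProbabilityMeasure μ] [IsProbabilityMeasure ρ]
    (hμ : HasCopula μ C) (hρ : HasCopula ρ C) :
    transportCost p p (diamond C μ ρ) ^ (1 / p) = wasserstein p p μ ρ := by
  refine le_antisymm (le_iInf₂ fun ν hν => ?_) 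
    (iInf₂_le (f := fun ν (_ : IsCoupling ν μ ρ) => transportCost p p ν ^ (1 / p)) _
      (isCoupling_diamond hμ hρ))
  exact ENNReal.rpow_le_rpow (transportCost_diamond_self_le hμ.1 hp hν) (by positivity)

theorem wasserstein_self_rpow_eq {n : ℕ} {C : (Fin n → unitInterval) → ℝ} {p : ℝ}
    (hp : 1 ≤ p) {μ ρ : Measure (Fin n → ℝ)} [IsProbabilityMeasure μ] [IsProbabilityMeasure ρ]
    (hμ : HasCopula μ C) (hρ : HasCopula ρ C) :
    wasserstein p p μ ρ ^ p = ∑ i, ∫⁻ t : unitInterval,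
      ENNReal.ofReal (|quantile (marginal μ i) t - quantile (marginal ρ i) t| ^ p) := by
  have hp0 : p ≠ 0 := by linarith
  rw [← transportCost_diamond_self_eq_wasserstein hp hμ hρ, ← ENNReal.rpow_mul, one_div,
    inv_mul_cancel₀ hp0, ENNReal.rpow_one, transportCost_diamond_self hμ.1 hp0]

theorem wasserstein_self_rpow_eq_lintegral_copulaMeasure {n : ℕ}
    {C : (Fin n → unitInterval) → ℝ} {p : ℝ}
    (hp : 1 ≤ p) {μ ρ : Measure (Fin n → ℝ)} [IsProbabilityMeasure μ] [IsProbabilityMeasure ρ]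
    (hμ : HasCopula μ C) (hρ : HasCopula ρ C) :
    wasserstein p p μ ρ ^ p = ∫⁻ u, ∑ i, ENNReal.ofReal
      (|quantile (marginal μ i) (u i) - quantile (marginal ρ i) (u i)| ^ p)
        ∂(copulaMeasure C) := by
  have h : ∀ i, Measurable fun t : unitInterval => ENNReal.ofReal
      (|quantile (marginal μ i) t - quantile (marginal ρ i) t| ^ p) := fun i => by
    have h1 := measurable_quantile (marginal μ i)
    have h2 := measurable_quantile (marginal ρ i)
    fun_prop
  rw [wasserstein_self_rpow_eq hp hμ hρ,
    lintegral_finsetSum (f := fun i (u : Fin n → unitInterval) => ENNReal.ofReal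
      (|quantile (marginal μ i) (u i) - quantile (marginal ρ i) (u i)| ^ p)) _
      fun i _ => (h i).comp (measurable_pi_apply i)]
  exact Finset.sum_congr rfl fun i _ =>
    (hμ.1.isCopulaLaw_copulaMeasure.lintegral_eval (h i) i).symm

theorem wasserstein_self_rpow_eq_setLIntegral {n : ℕ}
    {C : (Fin n → unitInterval) → ℝ} {p : ℝ}
    (hp : 1 ≤ p) {μ ρ : Measure (Fin n → ℝ)} [IsProbabilityMeasure μ] [IsProbabilityMeasure ρ]
    (hμ : HasCopula μ C) (hρ : HasCopula ρ C) :
    wasserstein p p μ ρ ^ p = ∫⁻ u in Set.Icc (0 : ℝ) 1, ∑ i, ENNReal.ofReal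
      (|quantile (marginal μ i) u - quantile (marginal ρ i) u| ^ p) := by
  have h : ∀ i, Measurable fun t : unitInterval => ENNReal.ofReal
      (|quantile (marginal μ i) t - quantile (marginal ρ i) t| ^ p) := fun i => by
    have h1 := measurable_quantile (marginal μ i)
    have h2 := measurable_quantile (marginal ρ i)
    fun_prop
  rw [wasserstein_self_rpow_eq hp hμ hρ, ← lintegral_finsetSum _ fun i _ => h i]
  exact lintegral_subtype_comap measurableSet_Icc fun u : ℝ => ∑ i, ENNReal.ofReal
    (|quantile (marginal μ i) u - quantile (marginal ρ i) u| ^ p)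

/-! ### Improving the diagonal coupling by a swap -/

/-- A failure of cyclical monotonicity on sets of positive mass: part of the diagonal over `S` and
`T` is replaced by the products `μ ⊗ ν` and `ν ⊗ μ` of the restrictions of `m`, and `κ` is the mass
left on the diagonal. -/
theorem exists_coupling_lintegral_lt {Ω : Type*} [MeasurableSpace Ω] {m : Measure Ω}
    [IsProbabilityMeasure m] {S T : Set Ω} (hS : MeasurableSet S) (hT : MeasurableSet T)
    (hS0 : m S ≠ 0) (hT0 : m T ≠ 0) {c : Ω × Ω → ℝ≥0∞} (hc : Measurable c)
    (hfin : ∫⁻ u, c (u, u) ∂m ≠ ∞)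
    (h : ∀ u ∈ S, ∀ v ∈ T, c (u, v) + c (v, u) < c (u, u) + c (v, v)) :
    ∃ π : Measure (Ω × Ω), π.map Prod.fst = m ∧ π.map Prod.snd = m ∧
      ∫⁻ z, c z ∂π < ∫⁻ u, c (u, u) ∂m := by
  have hdisj : Disjoint S T := Set.disjoint_left.2 fun u hu hu' => lt_irrefl _ (h u hu u hu')
  have hd : Measurable fun u : Ω => (u, u) := by fun_prop
  set μ := m.restrict S with hμ
  set ν := m.restrict T with hν
  set κ := m.restrict (S ∪ T)ᶜ + (1 - m T) • μ + (1 - m S) • ν with hκ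
  have hμu : μ Set.univ = m S := by simp [hμ]
  have hνu : ν Set.univ = m T := by simp [hν]
  -- The two products together have both marginals equal to `m T • μ + m S • ν`; the weights in `κ`
  -- compensate exactly.
  have hsum : κ + m T • μ + m S • ν = m := by
    have h1 : (1 - m T) • μ + m T • μ = μ := by
      rw [← add_smul, tsub_add_cancel_of_le prob_le_one, one_smul]
    have h2 : (1 - m S) • ν + m S • ν = ν := by
      rw [← add_smul, tsub_add_cancel_of_le prob_le_one, one_smul]
    calc κ + m T • μ + m S • ν = m.restrict (S ∪ T)ᶜ + (((1 - m T) • μ + m T • μ) +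
          ((1 - m S) • ν + m S • ν)) := by rw [hκ]; abel
      _ = m := by
        rw [h1, h2, hμ, hν, ← Measure.restrict_union hdisj hT, add_comm,
          Measure.restrict_add_restrict_compl (hS.union hT)]
  have hdiag : ∫⁻ u, c (u, u) ∂m = ∫⁻ u, c (u, u) ∂κ +
      ∫⁻ z, (c (z.1, z.1) + c (z.2, z.2)) ∂(μ.prod ν) := by
    have e1 : ∫⁻ z, c (z.1, z.1) ∂(μ.prod ν) = m T * ∫⁻ u, c (u, u) ∂μ := by
      rw [← lintegral_map (f := fun u => c (u, u)) (by fun_prop) measurable_fst,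
        Measure.map_fst_prod, lintegral_smul_measure, hνu, smul_eq_mul]
    have e2 : ∫⁻ z, c (z.2, z.2) ∂(μ.prod ν) = m S * ∫⁻ u, c (u, u) ∂ν := by
      rw [← lintegral_map (f := fun u => c (u, u)) (by fun_prop) measurable_snd,
        Measure.map_snd_prod, lintegral_smul_measure, hμu, smul_eq_mul]
    rw [lintegral_add_left (by fun_prop), e1, e2, ← add_assoc]
    conv_lhs => rw [← hsum]
    rw [lintegral_add_measure, lintegral_add_measure, lintegral_smul_measure,
      lintegral_smul_measure, smul_eq_mul, smul_eq_mul]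
  have hκfin : ∫⁻ u, c (u, u) ∂κ ≠ ∞ :=
    ne_top_of_le_ne_top hfin (by rw [hdiag]; exact le_self_add)
  have hPfin : ∫⁻ z, (c (z.1, z.1) + c (z.2, z.2)) ∂(μ.prod ν) ≠ ∞ :=
    ne_top_of_le_ne_top hfin (by rw [hdiag]; exact le_add_self)
  have hlt : ∀ᵐ z ∂(μ.prod ν), c z + c z.swap < c (z.1, z.1) + c (z.2, z.2) := by
    rw [hμ, hν, Measure.prod_restrict]
    filter_upwards [ae_restrict_mem (hS.prod hT)] with z hz
    exact h z.1 hz.1 z.2 hz.2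
  refine ⟨κ.map (fun u => (u, u)) + μ.prod ν + ν.prod μ, ?_, ?_, ?_⟩
  · rw [Measure.map_add _ _ measurable_fst, Measure.map_add _ _ measurable_fst,
      Measure.map_map measurable_fst hd, Measure.map_fst_prod, Measure.map_fst_prod, hμu, hνu]
    exact (congrArg (fun κ' => κ' + m T • μ + m S • ν) Measure.map_id).trans hsum
  · rw [Measure.map_add _ _ measurable_snd, Measure.map_add _ _ measurable_snd,
      Measure.map_map measurable_snd hd, Measure.map_snd_prod, Measure.map_snd_prod, hμu, hνu,
      add_right_comm]
    exact (congrArg (fun κ' => κ' + m T • μ + m S • ν) Measure.map_id).trans hsum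
  · rw [lintegral_add_measure, lintegral_add_measure, lintegral_map hc hd, hdiag, add_assoc]
    refine ENNReal.add_lt_add_left hκfin ?_
    rw [← Measure.prod_swap (μ := μ) (ν := ν), lintegral_map hc measurable_swap, ← lintegral_add_left hc]
    have hne : μ.prod ν ≠ 0 := by
      rw [← Measure.measure_univ_ne_zero, ← Set.univ_prod_univ, Measure.prod_prod, hμu, hνu]
      exact mul_ne_zero hS0 hT0
    refine lintegral_strict_mono hne (by fun_prop) ?_ hlt
    exact ne_top_of_le_ne_top hPfin (lintegral_mono_ae (hlt.mono fun z hz => hz.le))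

/-! ### Increasing images of a copula measure -/

theorem measureReal_map_Iic {g : unitInterval → ℝ} (hg : Monotone g) (x : ℝ) :
    (volume.map g).real (Set.Iic x) = volume.real {t | g t ≤ x} := by
  rw [map_measureReal_apply hg.measurable measurableSet_Iic]
  rfl

/-- The set `{g ≤ x}` is an initial segment, hence determined by its length except at its endpoint.
-/
theorem ae_le_iff_le_unitCdf {g : unitInterval → ℝ} (hg : Monotone g) {ν : Measure ℝ}
    [IsProbabilityMeasure ν] (hν : ν = volume.map g) (x : ℝ) :
    ∀ᵐ t, g t ≤ x ↔ t ≤ unitCdf ν x := by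
  have hs : ((unitCdf ν x : unitInterval) : ℝ) = volume.real {t | g t ≤ x} := by
    rw [← measureReal_map_Iic hg, ← hν]
    rfl
  filter_upwards [compl_mem_ae_iff.2 (measure_singleton (unitCdf ν x))] with t ht
  constructor
  · intro h
    rw [← Subtype.coe_le_coe, hs]
    have : volume.real (Set.Iic t) ≤ volume.real {t | g t ≤ x} :=
      measureReal_mono fun s hs => (hg hs).trans h
    simpa [measureReal_def, t.2.1] using this
  · intro h
    by_contra hgt
    refine ht (le_antisymm h ?_)
    rw [← Subtype.coe_le_coe, hs]
    have : volume.real {t | g t ≤ x} ≤ volume.real (Set.Iic t) :=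
      measureReal_mono fun s hs => le_of_not_gt fun hts => hgt ((hg hts.le).trans hs)
    simpa [measureReal_def, t.2.1] using this

theorem measureReal_map_Iic_self {g : unitInterval → ℝ} (hg : StrictMono g) (u : unitInterval) :
    (volume.map g).real (Set.Iic (g u)) = u := by
  rw [measureReal_map_Iic hg.monotone]
  simp only [hg.le_iff_le]
  change volume.real (Set.Iic u) = u
  simp [measureReal_def, u.2.1]

/-- The hypothesis `hu` is left continuity of the increasing `g` at `u`, as needed for the
left-continuous quantile to recover `g`. -/
theorem quantile_map_of_strictMono {g : unitInterval → ℝ} (hg : StrictMono g) {u : unitInterval}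
    (hu : ∀ x < g u, ∃ t < u, x < g t) : quantile (volume.map g) u = g u := by
  refine IsLeast.csInf_eq ⟨(measureReal_map_Iic_self hg u).ge, fun x hx => ?_⟩
  by_contra! hlt
  obtain ⟨t, htu, hxt⟩ := hu x hlt
  have h1 : (volume.map g).real (Set.Iic x) ≤ (volume.map g).real (Set.Iic (g t)) := by
    have : IsProbabilityMeasure (volume.map g) :=
      Measure.isProbabilityMeasure_map hg.monotone.measurable.aemeasurable
    exact measureReal_mono (Set.Iic_subset_Iic.2 hxt.le)
  rw [measureReal_map_Iic_self hg] at h1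
  exact absurd (le_trans hx h1) (not_le.2 htu)

theorem IsCopulaLaw.marginal_map {n : ℕ} {C : (Fin n → unitInterval) → ℝ}
    {m : Measure (Fin n → unitInterval)} (h : IsCopulaLaw C m) {f : Fin n → unitInterval → ℝ}
    (hf : ∀ i, Measurable (f i)) (i : Fin n) :
    marginal (m.map fun u i => f i (u i)) i = volume.map (f i) := by
  rw [marginal, Measure.map_map (measurable_pi_apply i) (by fun_prop), ← h.2.1 i,
    Measure.map_map (hf i) (measurable_pi_apply i)]
  rfl

/-- Strict monotonicity means the marginals have no atoms: their distribution functions take the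
value `u i` at `f i (u i)`, so the copula identity prescribes `C'` at every `u`. -/
theorem IsCopulaLaw.hasUniqueCopula_map {n : ℕ} {C : (Fin n → unitInterval) → ℝ}
    {m : Measure (Fin n → unitInterval)} (h : IsCopulaLaw C m) {f : Fin n → unitInterval → ℝ}
    (hf : ∀ i, StrictMono (f i)) [IsProbabilityMeasure (m.map fun u i => f i (u i))] :
    HasUniqueCopula (m.map fun u i => f i (u i)) C := by
  have := h.1
  have hfm : ∀ i, Measurable (f i) := fun i => (hf i).monotone.measurable
  have hmap : Measurable fun (u : Fin n → unitInterval) i => f i (u i) := by fun_prop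
  have hC : HasCopula (m.map fun u i => f i (u i)) C := by
    refine ⟨⟨m, h⟩, fun x => ?_⟩
    rw [h.2.2, map_measureReal_apply hmap (MeasurableSet.univ_pi fun i => measurableSet_Iic)]
    refine measureReal_congr (Filter.eventuallyEq_set.2 ?_)
    filter_upwards [ae_all_iff.2 fun i => h.ae_eval i
      (ae_le_iff_le_unitCdf (hf i).monotone (h.marginal_map hfm i) (x i))] with u hu
    simp only [Set.mem_preimage, Set.mem_univ_pi, Set.mem_Iic, Set.mem_Icc]
    refine forall_congr' fun i => ?_
    rw [hu i]
    exact ⟨fun h => ⟨unitInterval.nonneg', h⟩, fun h => h.2⟩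
  refine ⟨hC, fun C' hC' => funext fun u => ?_⟩
  have hu : (fun i => unitCdf (marginal (m.map fun u i => f i (u i)) i) (f i (u i))) = u := by
    funext i
    refine Subtype.ext ?_
    change (marginal (m.map fun u i => f i (u i)) i).real (Set.Iic (f i (u i))) = u i
    rw [h.marginal_map hfm, measureReal_map_Iic_self (hf i)]
  have h1 := hC.2 fun i => f i (u i)
  have h2 := hC'.2 fun i => f i (u i)
  rw [hu] at h1 h2
  exact h2.symm.trans h1

theorem transportCost_diamond_map {n : ℕ} {C : (Fin n → unitInterval) → ℝ} (hC : IsCopula C)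
    {f g : Fin n → unitInterval → ℝ} (hf : ∀ i, StrictMono (f i)) (hg : ∀ i, StrictMono (g i))
    (hfl : ∀ i u, 0 < u → ∀ x < f i u, ∃ t < u, x < f i t)
    (hgl : ∀ i u, 0 < u → ∀ x < g i u, ∃ t < u, x < g i t) (p q : ℝ) :
    transportCost p q (diamond C ((copulaMeasure C).map fun u i => f i (u i))
      ((copulaMeasure C).map fun u i => g i (u i))) =
    ∫⁻ u, ENNReal.ofReal (lqNorm q ((fun i => f i (u i)) - fun i => g i (u i)) ^ p)
      ∂(copulaMeasure C) := by
  have h := hC.isCopulaLaw_copulaMeasure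
  have hfm : ∀ i, Measurable (f i) := fun i => (hf i).monotone.measurable
  have hgm : ∀ i, Measurable (g i) := fun i => (hg i).monotone.measurable
  have heq : ∀ᵐ u ∂(copulaMeasure C),
      ((fun i => quantile (marginal ((copulaMeasure C).map fun u i => f i (u i)) i) (u i),
        fun i => quantile (marginal ((copulaMeasure C).map fun u i => g i (u i)) i) (u i)) :
        (Fin n → ℝ) × (Fin n → ℝ)) = (fun i => f i (u i), fun i => g i (u i)) := by
    filter_upwards [ae_all_iff.2 fun i => h.ae_eval i unitInterval.ae_pos_lt_one] with u hu
    refine Prod.ext (funext fun i => ?_) (funext fun i => ?_)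
    · dsimp only
      rw [h.marginal_map hfm]
      exact quantile_map_of_strictMono (hf i) (hfl i _ (hu i).1)
    · dsimp only
      rw [h.marginal_map hgm]
      exact quantile_map_of_strictMono (hg i) (hgl i _ (hu i).1)
  rw [diamond, Measure.map_congr heq, transportCost, lintegral_map]
  · unfold lqNorm
    fun_prop
  · fun_prop

theorem wasserstein_map_lt {n : ℕ} {C : (Fin n → unitInterval) → ℝ} (hC : IsCopula C)
    {f g : Fin n → unitInterval → ℝ} (hf : ∀ i, StrictMono (f i)) (hg : ∀ i, StrictMono (g i))
    (hfl : ∀ i u, 0 < u → ∀ x < f i u, ∃ t < u, x < f i t)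
    (hgl : ∀ i u, 0 < u → ∀ x < g i u, ∃ t < u, x < g i t) {p q : ℝ} (hp : 0 < p)
    {S T : Set (Fin n → unitInterval)} (hS : MeasurableSet S) (hT : MeasurableSet T)
    (hS0 : copulaMeasure C S ≠ 0) (hT0 : copulaMeasure C T ≠ 0)
    {c : (Fin n → unitInterval) × (Fin n → unitInterval) → ℝ}
    (hc : ∀ z, c z = lqNorm q ((fun i => f i (z.1 i)) - fun i => g i (z.2 i)) ^ p)
    {B : ℝ} (hB : ∀ u, c (u, u) ≤ B)
    (h : ∀ u ∈ S, ∀ v ∈ T, c (u, v) + c (v, u) < c (u, u) + c (v, v)) :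
    ∃ (μ ρ : Measure (Fin n → ℝ)) (_ : IsProbabilityMeasure μ) (_ : IsProbabilityMeasure ρ),
      HasUniqueCopula μ C ∧ HasUniqueCopula ρ C ∧
        wasserstein p q μ ρ < transportCost p q (diamond C μ ρ) ^ (1 / p) := by
  have hm := hC.isCopulaLaw_copulaMeasure
  have := hm.1
  have hfm : ∀ i, Measurable (f i) := fun i => (hf i).monotone.measurable
  have hgm : ∀ i, Measurable (g i) := fun i => (hg i).monotone.measurable
  have hfm' : Measurable fun (u : Fin n → unitInterval) i => f i (u i) := by fun_prop
  have hgm' : Measurable fun (u : Fin n → unitInterval) i => g i (u i) := by fun_prop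
  have hμ := Measure.isProbabilityMeasure_map (μ := copulaMeasure C) hfm'.aemeasurable
  have hρ := Measure.isProbabilityMeasure_map (μ := copulaMeasure C) hgm'.aemeasurable
  have hc0 : ∀ z, 0 ≤ c z := fun z => by
    rw [hc]
    exact Real.rpow_nonneg (lqNorm_nonneg _ _) _
  have hcm : Measurable c := by
    rw [funext hc]
    unfold lqNorm
    simp only [Pi.sub_apply]
    fun_prop
  obtain ⟨π, h1, h2, hlt⟩ := exists_coupling_lintegral_lt (m := copulaMeasure C) hS hT hS0 hT0
    (c := fun z => ENNReal.ofReal (c z)) (by fun_prop)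
    ((lintegral_mono fun u => ENNReal.ofReal_le_ofReal (hB u)).trans_lt (by simp)).ne
    (fun u hu v hv => by
      rw [← ENNReal.ofReal_add (hc0 _) (hc0 _), ← ENNReal.ofReal_add (hc0 _) (hc0 _)]
      exact (ENNReal.ofReal_lt_ofReal_iff_of_nonneg (add_nonneg (hc0 _) (hc0 _))).2 (h u hu v hv))
  refine ⟨_, _, hμ, hρ, hm.hasUniqueCopula_map hf, hm.hasUniqueCopula_map hg, ?_⟩
  have hπ : Measurable fun z : (Fin n → unitInterval) × (Fin n → unitInterval) =>
      ((fun i => f i (z.1 i), fun i => g i (z.2 i)) : (Fin n → ℝ) × (Fin n → ℝ)) := by fun_prop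
  have hcoup : IsCoupling (π.map fun z => (fun i => f i (z.1 i), fun i => g i (z.2 i)))
      ((copulaMeasure C).map fun u i => f i (u i))
      ((copulaMeasure C).map fun u i => g i (u i)) := by
    constructor
    · rw [Measure.map_map measurable_fst hπ, ← h1, Measure.map_map hfm' measurable_fst]
      rfl
    · rw [Measure.map_map measurable_snd hπ, ← h2, Measure.map_map hgm' measurable_snd]
      rfl
  rw [transportCost_diamond_map hC hf hg hfl hgl]
  refine (iInf₂_le (f := fun ν (_ : IsCoupling ν _ _) => transportCost p q ν ^ (1 / p))
    _ hcoup).trans_lt (ENNReal.rpow_lt_rpow ?_ (by positivity))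
  rw [transportCost, lintegral_map _ hπ]
  · simpa only [hc] using hlt
  · unfold lqNorm
    fun_prop

/-! ### Tilted step maps and the gap between costs -/

theorem lqNorm_rpow_eq {n : ℕ} {q : ℝ} (p : ℝ) (x : Fin n → ℝ) :
    lqNorm q x ^ p = (∑ i, |x i| ^ q) ^ (p / q) := by
  rw [lqNorm, ← Real.rpow_mul (Finset.sum_nonneg fun _ _ => Real.rpow_nonneg (abs_nonneg _) _),
    one_div_mul_eq_div]

theorem continuous_lqNorm_rpow {n : ℕ} {p q : ℝ} (hp : 0 < p) (hq : 0 < q) :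
    Continuous fun x : Fin n → ℝ => lqNorm q x ^ p := by
  simp_rw [lqNorm_rpow_eq]
  refine Continuous.rpow_const (continuous_finsetSum _ fun i _ => ?_)
    fun x => Or.inr (by positivity)
  exact Continuous.rpow_const (by fun_prop) fun x => Or.inr hq.le

/-- The strictly increasing function `t ↦ ε t`, shifted down by `1` on `[0, c]`. -/
noncomputable def tiltedStep (P : Prop) [Decidable P] (c : unitInterval) (ε : ℝ)
    (t : unitInterval) : ℝ :=
  ε * t - if P ∧ t ≤ c then 1 else 0

theorem tiltedStep_strictMono (P : Prop) [Decidable P] (c : unitInterval) {ε : ℝ} (hε : 0 < ε) :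
    StrictMono (tiltedStep P c ε) := by
  intro s t hst
  have h1 : ε * s < ε * t := mul_lt_mul_of_pos_left hst hε
  unfold tiltedStep
  by_cases ht : P ∧ t ≤ c
  · rw [if_pos ht, if_pos ⟨ht.1, hst.le.trans ht.2⟩]
    linarith
  · rw [if_neg ht]
    split_ifs <;> linarith

/-- Left continuity: the jump at `c` occurs just after `c`, since the shift applies on the closed
segment `t ≤ c`. -/
theorem tiltedStep_exists_lt (P : Prop) [Decidable P] (c : unitInterval) (ε : ℝ)
    (u : unitInterval) (hu : 0 < u) (x : ℝ) (hx : x < tiltedStep P c ε u) :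
    ∃ t < u, x < tiltedStep P c ε t := by
  have hcont : Continuous fun t : unitInterval => ε * (t : ℝ) := by fun_prop
  have hne : (nhdsWithin u (Set.Iio u)).NeBot := nhdsLT_neBot_of_exists_lt ⟨0, hu⟩
  unfold tiltedStep at *
  have key : ∀ᶠ t : unitInterval in nhdsWithin u (Set.Iio u),
      x + (if P ∧ u ≤ c then 1 else 0) < ε * (t : ℝ) :=
    nhdsWithin_le_nhds (hcont.continuousAt.eventually (lt_mem_nhds (by linarith)))
  by_cases hP : P ∧ u ≤ c
  · obtain ⟨t, ht, htu⟩ := (key.and self_mem_nhdsWithin).exists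
    refine ⟨t, htu, ?_⟩
    rw [if_pos hP] at ht
    rw [if_pos ⟨hP.1, (Set.mem_Iio.1 htu).le.trans hP.2⟩]
    linarith
  · rw [if_neg hP] at key
    have h2 : ∀ᶠ t : unitInterval in nhdsWithin u (Set.Iio u), ¬ (P ∧ t ≤ c) := by
      by_cases hP' : P
      · have hcu : c < u := not_le.1 fun h => hP ⟨hP', h⟩
        filter_upwards [nhdsWithin_le_nhds (lt_mem_nhds hcu)] with t ht h
        exact not_lt.2 h.2 ht
      · exact Filter.Eventually.of_forall fun t h => hP' h.1
    obtain ⟨t, ⟨ht, ht2⟩, htu⟩ := ((key.and h2).and self_mem_nhdsWithin).exists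
    refine ⟨t, htu, ?_⟩
    rw [if_neg ht2]
    linarith

/-- The vector `e_i` if `P`, minus `e_j` if `Q`. -/
def unitDiff {n : ℕ} (i j : Fin n) (P Q : Prop) [Decidable P] [Decidable Q] (l : Fin n) : ℝ :=
  (if l = i ∧ P then 1 else 0) - if l = j ∧ Q then 1 else 0

theorem lqNorm_unitDiff_rpow {n : ℕ} {i j : Fin n} (hij : i ≠ j) {p q : ℝ} (hp : 0 < p)
    (hq : 0 < q) (P Q : Prop) [Decidable P] [Decidable Q] :
    lqNorm q (unitDiff i j P Q) ^ p =
      if P then (if Q then 2 ^ (p / q) else 1) else (if Q then 1 else 0) := by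
  have habs : ∀ l, |unitDiff i j P Q l| ^ q =
      (if l = i then (if P then 1 else 0) else 0) + if l = j then (if Q then 1 else 0) else 0 := by
    intro l
    unfold unitDiff
    by_cases hi : l = i
    · have hj : l ≠ j := fun h => hij (hi.symm.trans h)
      by_cases hP : P <;> simp [hi, hij, hP, hq.ne']
    · by_cases hj : l = j <;> by_cases hQ : Q <;> simp [hi, hj, hQ, hq.ne', hij.symm]
  rw [lqNorm_rpow_eq, Finset.sum_congr rfl fun l _ => habs l, Finset.sum_add_distrib]
  simp only [Finset.sum_ite_eq', Finset.mem_univ, if_true]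
  have : p / q ≠ 0 := by positivity
  by_cases hP : P <;> by_cases hQ : Q <;> simp [hP, hQ, one_add_one_eq_two, Real.zero_rpow this]

theorem Continuous.exists_abs_sub_lt {n : ℕ} {N : (Fin n → ℝ) → ℝ} (hN : Continuous N)
    {Z : Set (Fin n → ℝ)} (hZ : Z.Finite) {δ : ℝ} (hδ : 0 < δ) :
    ∃ ε : ℝ, 0 < ε ∧ ∀ z ∈ Z, ∀ w : Fin n → ℝ, (∀ l, |w l| ≤ 1) → |N (ε • w + z) - N z| < δ := by
  have h : ∀ z ∈ Z, ∀ᶠ ε in nhdsWithin (0 : ℝ) (Set.Ioi 0),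
      ∀ w : Fin n → ℝ, (∀ l, |w l| ≤ 1) → |N (ε • w + z) - N z| < δ := by
    intro z _
    obtain ⟨r, hr, h⟩ := Metric.continuousAt_iff.1 (hN.continuousAt (x := z)) δ hδ
    filter_upwards [Ioo_mem_nhdsGT hr] with ε hε w hw
    refine h ?_
    rw [dist_eq_norm, add_sub_cancel_right, norm_smul, Real.norm_of_nonneg hε.1.le]
    have : ‖w‖ ≤ 1 := (pi_norm_le_iff_of_nonneg zero_le_one).2 hw
    nlinarith [hε.1, hε.2]
  obtain ⟨ε, h1, h2⟩ := (((Filter.eventually_all_finite hZ).2 h).and self_mem_nhdsWithin).exists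
  exact ⟨ε, h2, h1⟩

/-- `K` is the limiting cost at `ε = 0`. Each of the four costs in the swap inequality moves by less
than `δ` for small `ε`, whence the margin `4 * δ`. -/
theorem exists_wasserstein_lt_of_gap {n : ℕ} {C : (Fin n → unitInterval) → ℝ} (hC : IsCopula C)
    {i j : Fin n} (hij : i ≠ j) {a b : unitInterval} {p q : ℝ} (hp : 0 < p) (hq : 0 < q)
    {S T : Set (Fin n → unitInterval)} (hS : MeasurableSet S) (hT : MeasurableSet T)
    (hS0 : copulaMeasure C S ≠ 0) (hT0 : copulaMeasure C T ≠ 0) {δ : ℝ} (hδ : 0 < δ)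
    {K : (Fin n → unitInterval) → (Fin n → unitInterval) → ℝ}
    (hK : ∀ u v, K u v = if v i ≤ a then (if u j ≤ b then 2 ^ (p / q) else 1)
      else (if u j ≤ b then 1 else 0))
    (h : ∀ u ∈ S, ∀ v ∈ T, K u v + K v u + 4 * δ ≤ K u u + K v v) :
    ∃ (μ ρ : Measure (Fin n → ℝ)) (_ : IsProbabilityMeasure μ) (_ : IsProbabilityMeasure ρ),
      HasUniqueCopula μ C ∧ HasUniqueCopula ρ C ∧
        wasserstein p q μ ρ < transportCost p q (diamond C μ ρ) ^ (1 / p) := by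
  have hK' : ∀ u v, K u v = lqNorm q (unitDiff i j (v i ≤ a) (u j ≤ b)) ^ p := fun u v => by
    rw [hK, lqNorm_unitDiff_rpow hij hp hq]
  -- There are at most four untilted differences, one for each pair of truth values, so a single `ε`
  -- serves for all points.
  have hfin : (Set.range fun z : (Fin n → unitInterval) × (Fin n → unitInterval) =>
      unitDiff i j (z.2 i ≤ a) (z.1 j ≤ b)).Finite := by
    classical
    refine (Set.finite_range fun x : Prop × Prop => unitDiff i j x.1 x.2).subset ?_
    rintro _ ⟨z, rfl⟩
    refine ⟨(z.2 i ≤ a, z.1 j ≤ b), ?_⟩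
    funext l
    simp only [unitDiff]
  obtain ⟨ε, hε, hclose⟩ := (continuous_lqNorm_rpow (n := n) hp hq).exists_abs_sub_lt hfin hδ
  set c : (Fin n → unitInterval) × (Fin n → unitInterval) → ℝ := fun z =>
    lqNorm q ((fun l => tiltedStep (l = j) b ε (z.1 l)) -
      fun l => tiltedStep (l = i) a ε (z.2 l)) ^ p with hc
  have hcK : ∀ u v, |c (u, v) - K u v| < δ := by
    intro u v
    have hw := hclose _ ⟨(u, v), rfl⟩ (fun l => (u l : ℝ) - v l) fun l => by
      rw [abs_le]
      constructor <;> linarith [(u l).2.1, (u l).2.2, (v l).2.1, (v l).2.2]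
    rw [hK', hc]
    convert hw using 5
    funext l
    simp only [tiltedStep, unitDiff, Pi.sub_apply, Pi.add_apply, Pi.smul_apply, smul_eq_mul]
    have e1 : (if l = j ∧ u l ≤ b then (1 : ℝ) else 0) = if l = j ∧ u j ≤ b then 1 else 0 := by
      by_cases hl : l = j
      · rw [hl]
      · simp [hl]
    have e2 : (if l = i ∧ v l ≤ a then (1 : ℝ) else 0) = if l = i ∧ v i ≤ a then 1 else 0 := by
      by_cases hl : l = i
      · rw [hl]
      · simp [hl]
    rw [e1, e2]
    ring
  have hKB : ∀ u v, K u v ≤ 2 ^ (p / q) + 1 := by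
    intro u v
    have : (0 : ℝ) < 2 ^ (p / q) := by positivity
    rw [hK]
    split_ifs <;> linarith
  refine wasserstein_map_lt hC (fun l => tiltedStep_strictMono (l = j) b hε)
    (fun l => tiltedStep_strictMono (l = i) a hε)
    (fun l => tiltedStep_exists_lt (l = j) b ε)
    (fun l => tiltedStep_exists_lt (l = i) a ε) hp hS hT hS0 hT0 (c := c) (fun z => rfl)
    (B := 2 ^ (p / q) + 1 + δ) (fun u => ?_) (fun u hu v hv => ?_)
  · linarith [(abs_lt.1 (hcK u u)).2, hKB u u]
  · linarith [h u hu v hv, (abs_lt.1 (hcK u u)).1, (abs_lt.1 (hcK v v)).1,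
      (abs_lt.1 (hcK u v)).2, (abs_lt.1 (hcK v u)).2]

theorem measurableSet_eval_le {n : ℕ} (i : Fin n) (a : unitInterval) :
    MeasurableSet {u : Fin n → unitInterval | u i ≤ a} :=
  measurableSet_le (measurable_pi_apply i) measurable_const

theorem exists_wasserstein_lt_of_lt {n : ℕ} {C : (Fin n → unitInterval) → ℝ} (hC : IsCopula C)
    {i j : Fin n} (hij : i ≠ j) {a b : unitInterval} {p q : ℝ} (hp : 0 < p) (hpq : p < q)
    (hS : copulaMeasure C ({u | u i ≤ a} \ {u | u j ≤ b}) ≠ 0)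
    (hT : copulaMeasure C ({u | u j ≤ b} \ {u | u i ≤ a}) ≠ 0) :
    ∃ (μ ρ : Measure (Fin n → ℝ)) (_ : IsProbabilityMeasure μ) (_ : IsProbabilityMeasure ρ),
      HasUniqueCopula μ C ∧ HasUniqueCopula ρ C ∧
        wasserstein p q μ ρ < transportCost p q (diamond C μ ρ) ^ (1 / p) := by
  have hq : 0 < q := hp.trans hpq
  have h2 : (2 : ℝ) ^ (p / q) < 2 := by
    conv_rhs => rw [← Real.rpow_one 2]
    exact Real.rpow_lt_rpow_of_exponent_lt one_lt_two ((div_lt_one hq).2 hpq)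
  refine exists_wasserstein_lt_of_gap (a := a) (b := b) hC hij hp hq
    ((measurableSet_eval_le i a).diff (measurableSet_eval_le j b))
    ((measurableSet_eval_le j b).diff (measurableSet_eval_le i a)) hS hT
    (δ := (2 - 2 ^ (p / q)) / 4) (by linarith) (fun u v => rfl) ?_
  -- The diagonal costs are `1 + 1`; the swapped ones are `0 + 2 ^ (p / q)`.
  rintro u ⟨hu1, hu2⟩ v ⟨hv1, hv2⟩
  simp only [Set.mem_ofPred_eq] at hu1 hu2 hv1 hv2
  simp only [hu1, hu2, hv1, hv2, if_true, if_false]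
  linarith

theorem exists_wasserstein_lt_of_gt {n : ℕ} {C : (Fin n → unitInterval) → ℝ} (hC : IsCopula C)
    {i j : Fin n} (hij : i ≠ j) {a b : unitInterval} {p q : ℝ} (hq : 0 < q) (hpq : q < p)
    (hS : copulaMeasure C ({u | u i ≤ a} ∩ {u | u j ≤ b}) ≠ 0)
    (hT : copulaMeasure C ({u | u i ≤ a} ∪ {u | u j ≤ b})ᶜ ≠ 0) :
    ∃ (μ ρ : Measure (Fin n → ℝ)) (_ : IsProbabilityMeasure μ) (_ : IsProbabilityMeasure ρ),
      HasUniqueCopula μ C ∧ HasUniqueCopula ρ C ∧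
        wasserstein p q μ ρ < transportCost p q (diamond C μ ρ) ^ (1 / p) := by
  have hp : 0 < p := hq.trans hpq
  have h2 : (2 : ℝ) < 2 ^ (p / q) := by
    conv_lhs => rw [← Real.rpow_one 2]
    exact Real.rpow_lt_rpow_of_exponent_lt one_lt_two ((one_lt_div hq).2 hpq)
  refine exists_wasserstein_lt_of_gap (a := a) (b := b) hC hij hp hq
    ((measurableSet_eval_le i a).inter (measurableSet_eval_le j b))
    ((measurableSet_eval_le i a).union (measurableSet_eval_le j b)).compl hS hT
    (δ := (2 ^ (p / q) - 2) / 4) (by linarith) (fun u v => rfl) ?_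
  -- The diagonal costs are `2 ^ (p / q) + 0`; the swapped ones are `1 + 1`.
  rintro u ⟨hu1, hu2⟩ v hv
  simp only [Set.mem_ofPred_eq, Set.mem_compl_iff, Set.mem_union, not_or] at hu1 hu2 hv
  simp only [hu1, hu2, hv.1, hv.2, if_true, if_false]
  linarith

/-! ### Regions charged by the copula, and the Fréchet bounds -/

theorem IsCopulaLaw.measureReal_eval_le {n : ℕ} {C : (Fin n → unitInterval) → ℝ}
    {m : Measure (Fin n → unitInterval)} (h : IsCopulaLaw C m) (i : Fin n) (a : unitInterval) :
    m.real {u | u i ≤ a} = a := by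
  have : m.real {u | u i ≤ a} = (m.map fun u => u i).real (Set.Iic a) := by
    rw [map_measureReal_apply (measurable_pi_apply i) measurableSet_Iic]
    rfl
  rw [this, h.2.1 i]
  simp [measureReal_def, a.2.1]

/-- The hypothesis nests the half-spaces `{v j ≤ u j}` up to null sets, so their intersection is the
smallest of them, of mass `min u`. -/
theorem IsCopulaLaw.eq_frechetUpper {n : ℕ} (hn : 0 < n) {C : (Fin n → unitInterval) → ℝ}
    {m : Measure (Fin n → unitInterval)} (h : IsCopulaLaw C m)
    (hm : ∀ i j, i ≠ j → ∀ a b : unitInterval, m ({u | u i ≤ a} \ {u | u j ≤ b}) = 0 ∨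
      m ({u | u j ≤ b} \ {u | u i ≤ a}) = 0) : C = frechetUpper n := by
  have := h.1
  have : Nonempty (Fin n) := ⟨⟨0, hn⟩⟩
  funext u
  obtain ⟨k, hk⟩ := Finite.exists_min fun i => (u i : ℝ)
  have hinf : frechetUpper n u = u k :=
    le_antisymm (ciInf_le (Set.finite_range _).bddBelow k) (le_ciInf hk)
  have hnull : ∀ j, m ({v | v k ≤ u k} \ {v | v j ≤ u j}) = 0 := by
    intro j
    by_cases hkj : k = j
    · subst hkj
      simp
    rcases hm k j hkj (u k) (u j) with h0 | h0
    · exact h0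
    -- If the nesting goes the other way, the masses satisfy `u j ≤ u k`, and minimality of `u k`
    -- makes both differences null.
    · have h1 := measureReal_sdiff_add_inter (μ := m) (s := {v | v k ≤ u k})
        (measurableSet_eval_le j (u j))
      have h2 := measureReal_sdiff_add_inter (μ := m) (s := {v | v j ≤ u j})
        (measurableSet_eval_le k (u k))
      rw [h.measureReal_eval_le] at h1 h2
      rw [Set.inter_comm, measureReal_def, h0, ENNReal.toReal_zero] at h2
      have h3 := hk j
      have h4 : m.real ({v | v k ≤ u k} \ {v | v j ≤ u j}) = 0 :=
        le_antisymm (by linarith) measureReal_nonneg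
      exact (measureReal_eq_zero_iff).1 h4
  rw [hinf, h.2.2, ← h.measureReal_eval_le k (u k)]
  refine measureReal_congr (Filter.eventuallyEq_set.2 ?_)
  filter_upwards [ae_all_iff.2 fun j => measure_eq_zero_iff_ae_notMem.1 (hnull j)] with v hv
  simp only [Set.mem_univ_pi, Set.mem_Icc, Set.mem_ofPred_eq, Set.mem_sdiff, not_and, not_not] at hv ⊢
  exact ⟨fun hv => (hv k).2, fun hvk j => ⟨unitInterval.nonneg', hv j hvk⟩⟩

theorem IsCopulaLaw.measureReal_compl_union {n : ℕ} {C : (Fin n → unitInterval) → ℝ}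
    {m : Measure (Fin n → unitInterval)} (h : IsCopulaLaw C m) (i j : Fin n)
    (a b : unitInterval) :
    m.real ({u | u i ≤ a} ∪ {u | u j ≤ b})ᶜ =
      1 - (a + b - m.real ({u | u i ≤ a} ∩ {u | u j ≤ b})) := by
  have := h.1
  rw [probReal_compl_eq_one_sub ((measurableSet_eval_le i a).union (measurableSet_eval_le j b))]
  have := measureReal_union_add_inter (μ := m) (s := {u | u i ≤ a}) (measurableSet_eval_le j b)
  rw [h.measureReal_eval_le, h.measureReal_eval_le] at this
  linarith

theorem IsCopulaLaw.exists_inter_ne_zero {n : ℕ} {C : (Fin n → unitInterval) → ℝ}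
    {m : Measure (Fin n → unitInterval)} (h : IsCopulaLaw C m)
    (hn : 3 ≤ n ∨ (n = 2 ∧ C ≠ frechetLower n)) :
    ∃ i j, i ≠ j ∧ ∃ a b : unitInterval, m ({u | u i ≤ a} ∩ {u | u j ≤ b}) ≠ 0 ∧
      m ({u | u i ≤ a} ∪ {u | u j ≤ b})ᶜ ≠ 0 := by
  have := h.1
  suffices H : ∃ i j, i ≠ j ∧ ∃ a b : unitInterval, m.real ({u | u i ≤ a} ∩ {u | u j ≤ b}) ≠ 0 ∧
      m.real ({u | u i ≤ a} ∪ {u | u j ≤ b})ᶜ ≠ 0 by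
    obtain ⟨i, j, hij, a, b, h1, h2⟩ := H
    exact ⟨i, j, hij, a, b, mt (measureReal_eq_zero_iff).2 h1, mt (measureReal_eq_zero_iff).2 h2⟩
  rcases hn with hn | ⟨rfl, hC⟩
  · by_contra! H
    -- At the median the intersection and the complement of the union have equal mass, so both
    -- vanish for every pair. Three events of mass `1 / 2` would then be pairwise disjoint up to
    -- null sets.
    let c : unitInterval := ⟨1 / 2, by norm_num, by norm_num⟩
    have hc : (c : ℝ) = 1 / 2 := rfl
    have h0 : ∀ i j, i ≠ j → m.real ({u | u i ≤ c} ∩ {u | u j ≤ c}) = 0 := by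
      intro i j hij
      by_contra hne
      have h1 := H i j hij c c hne
      rw [h.measureReal_compl_union, hc] at h1
      exact hne (by linarith)
    let i : Fin n := ⟨0, by omega⟩
    let j : Fin n := ⟨1, by omega⟩
    let k : Fin n := ⟨2, by omega⟩
    have hij : i ≠ j := by simp [i, j]
    have hik : i ≠ k := by simp [i, k]
    have hjk : j ≠ k := by simp [j, k]
    have hcompl := h.measureReal_compl_union i j c c
    rw [h0 i j hij, hc] at hcompl
    have hsub : {u : Fin n → unitInterval | u k ≤ c} ⊆ ({u | u i ≤ c} ∪ {u | u j ≤ c})ᶜ ∪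
        (({u | u i ≤ c} ∩ {u | u k ≤ c}) ∪ ({u | u j ≤ c} ∩ {u | u k ≤ c})) := by
      intro u hu
      simp only [Set.mem_union, Set.mem_compl_iff, Set.mem_inter_iff, Set.mem_ofPred_eq] at hu ⊢
      tauto
    have h1 := measureReal_mono (μ := m) hsub
    have h2 := h1.trans (measureReal_union_le _ _)
    have h3 := measureReal_union_le (μ := m) ({u : Fin n → unitInterval | u i ≤ c} ∩ {u | u k ≤ c})
      ({u | u j ≤ c} ∩ {u | u k ≤ c})
    rw [h0 i k hik, h0 j k hjk] at h3
    rw [h.measureReal_eval_le, hc] at h2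
    linarith
  · obtain ⟨u, hu⟩ := Function.ne_iff.1 hC
    have hCu : C u = m.real ({v | v 0 ≤ u 0} ∩ {v | v 1 ≤ u 1}) := by
      rw [h.2.2]
      congr 1
      ext v
      simp only [Set.mem_univ_pi, Fin.forall_fin_two, Set.mem_Icc, unitInterval.nonneg', true_and,
        Set.mem_inter_iff, Set.mem_ofPred_eq]
    have hcompl := h.measureReal_compl_union 0 1 (u 0) (u 1)
    have hnn := measureReal_nonneg (μ := m) (s := ({v | v 0 ≤ u 0} ∪ {v | v 1 ≤ u 1})ᶜ)
    have hnn' := measureReal_nonneg (μ := m) (s := {v | v 0 ≤ u 0} ∩ {v | v 1 ≤ u 1})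
    rw [frechetLower, Fin.sum_univ_two, hCu] at hu
    push_cast at hu
    -- The complement of the union has mass `C u - (u 0 + u 1 - 1)`. If either mass vanishes,
    -- nonnegativity of the other gives `C u = max (u 0 + u 1 - 1) 0`.
    refine ⟨0, 1, by simp, u 0, u 1, fun h0 => hu ?_, fun h0 => hu ?_⟩
    · rw [h0, max_eq_right]
      linarith
    · rw [max_eq_left] <;> linarith

theorem proposition1 (n : ℕ) (hn : 2 ≤ n) (C : (Fin n → unitInterval) → ℝ) (hC : IsCopula C) :
    (∀ p : ℝ, 1 ≤ p →
      ∀ (μ ρ : Measure (Fin n → ℝ)) [IsProbabilityMeasure μ] [IsProbabilityMeasure ρ],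
        HasCopula μ C → HasCopula ρ C →
          IsCoupling (diamond C μ ρ) μ ρ ∧
          transportCost p p (diamond C μ ρ) ^ (1 / p) = wasserstein p p μ ρ ∧
          wasserstein p p μ ρ ^ p =
            ∫⁻ u, ∑ i, ENNReal.ofReal
              (|quantile (marginal μ i) (u i) - quantile (marginal ρ i) (u i)| ^ p)
                ∂(copulaMeasure C) ∧
          wasserstein p p μ ρ ^ p =
            ∫⁻ u in Set.Icc (0 : ℝ) 1, ∑ i, ENNReal.ofReal
              (|quantile (marginal μ i) u - quantile (marginal ρ i) u| ^ p)) ∧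
    (∀ p q : ℝ, 1 ≤ p → p < q → C ≠ frechetUpper n →
      ∃ (μ ρ : Measure (Fin n → ℝ)) (_ : IsProbabilityMeasure μ) (_ : IsProbabilityMeasure ρ),
        HasUniqueCopula μ C ∧ HasUniqueCopula ρ C ∧
          wasserstein p q μ ρ < transportCost p q (diamond C μ ρ) ^ (1 / p)) ∧
    (∀ p q : ℝ, 1 ≤ q → q < p → (3 ≤ n ∨ (n = 2 ∧ C ≠ frechetLower n)) →
      ∃ (μ ρ : Measure (Fin n → ℝ)) (_ : IsProbabilityMeasure μ) (_ : IsProbabilityMeasure ρ),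
        HasUniqueCopula μ C ∧ HasUniqueCopula ρ C ∧
          wasserstein p q μ ρ < transportCost p q (diamond C μ ρ) ^ (1 / p)) := by
  have hm := hC.isCopulaLaw_copulaMeasure
  refine ⟨fun p hp μ ρ _ _ hμ hρ => ⟨isCoupling_diamond hμ hρ,
    transportCost_diamond_self_eq_wasserstein hp hμ hρ,
    wasserstein_self_rpow_eq_lintegral_copulaMeasure hp hμ hρ,
    wasserstein_self_rpow_eq_setLIntegral hp hμ hρ⟩, fun p q hp hpq hne => ?_,
    fun p q hq hpq hn' => ?_⟩
  · by_contra H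
    refine hne (hm.eq_frechetUpper (by omega) fun i j hij a b => ?_)
    by_contra! hab
    exact H (exists_wasserstein_lt_of_lt hC hij (by linarith) hpq hab.1 hab.2)
  · obtain ⟨i, j, hij, a, b, h1, h2⟩ := hm.exists_inter_ne_zero hn'
    exact exists_wasserstein_lt_of_gt hC hij (by linarith) hpq h1 h2
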